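/- Let $(\mathcal X,d)$ be a metric space equipped with a Borel measure $\mu$ which is doubling, that is, $0<\mu(B)<\infty$ for every open ball $B$ and there is a constant $D$ with $\mu(B(x,2r))\le D\,\mu(B(x,r))$ for all $x\in\mathcal X$, $r>0$. Assume that there are $n>0$ and $c>0$ with $\mu(B(x,r))\ge c\,r^n$ for all $x\in\mathcal X$, $r>0$. For a ball $B$ write $r(B)$ for its radius, and for $0<\alpha<n$ put $$M_\alpha f(x)=\sup_{B\ni x} r(B)^\alpha\,\frac1{\mu(B)}\int_B|f|\,d\mu ,$$ the supremum being over all balls $B$ containing $x$. A weight is a non-negative locally integrable function on $\mathcal X$. For $1\le p\le q<\infty$, a weight $w$ belongs to $A_{p,q}$ if there is a constant $C$ such that for every ball $B$ $$\Big(\frac1{\mu(B)}\int_B w^q\,d\mu\Big)^{1/q}\Big(\frac1{\mu(B)}\int_B w^{-p'}\,d\mu\Big)^{1/p'}\le C\quad\text{if }p>1,\ \text{where } 1/p+1/p'=1,$$ $$\Big(\frac1{\mu(B)}\int_B w^q\,d\mu\Big)^{1/q}\le C\,w(x)\ \text{ for $\mu$-a.e. }x\in B\quad\text{if }p=1.$$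 Let $0<\alpha<n$, $1\le p<n/\alpha$, $1/q=1/p-\alpha/n$ and $w\in A_{p,q}$. If $p>1$, then $M_\alpha$ maps $L^p(w^p)$ boundedly into $L^q(w^q)$: there is a constant $C<\infty$ such that for every $f\in L^p(w^p\,d\mu)$, $M_\alpha f\in L^q(w^q\,d\mu)$ and $$\|M_\alpha f\|_{L^q(w^q\,d\mu)}\le C\,\|f\|_{L^p(w^p\,d\mu)} .$$ If $p=1$, then $M_\alpha$ maps $L^1(w)$ boundedly into $L^{q,\infty}(w^q)$: there is a constant $C<\infty$ such that for every $f\in L^1(w\,d\mu)$, $M_\alpha f\in L^{q,\infty}(w^q\,d\mu)$ and $$\sup_{\lambda>0}\lambda\Big(\int_{\{M_\alpha f>\lambda\}}w^q\,d\mu\Big)^{1/q}\le C\,\|f\|_{L^1(w\,d\mu)} .$$ -/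

import Mathlib

open MeasureTheory Metric
open scoped ENNReal NNReal

namespace HomogeneousType

variable {X : Type*} [MetricSpace X] [MeasurableSpace X]

/-- `μ` is a doubling measure: every ball has positive finite measure, and the measure of a ball
controls the measure of the concentric ball of twice the radius. -/
structure IsDoubling (μ : Measure X) : Prop where
  measure_ball_pos : ∀ (x : X) (r : ℝ), 0 < r → 0 < μ (ball x r)
  measure_ball_lt_top : ∀ (x : X) (r : ℝ), 0 < r → μ (ball x r) < ∞
  doubling : ∃ D : ℝ≥0, ∀ (x : X) (r : ℝ), 0 < r → μ (ball x (2 * r)) ≤ D * μ (ball x r)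

/-- Polynomial growth from below: `μ(B) ≥ c r(B)^n` for all balls `B`. -/
def HasLowerGrowth (μ : Measure X) (n : ℝ) : Prop :=
  ∃ c : ℝ≥0, 0 < c ∧ ∀ (x : X) (r : ℝ), 0 < r → c * ENNReal.ofReal (r ^ n) ≤ μ (ball x r)

/-- A weight: a non-negative, locally integrable function. -/
structure IsWeight (μ : Measure X) (w : X → ℝ) : Prop where
  nonneg : ∀ x, 0 ≤ w x
  aemeasurable : AEMeasurable w μ
  locallyIntegrable : LocallyIntegrable w μ

/-- The class `A_{p,q}`. Integrals and powers are taken in `[0, ∞]`, so that `w ^ (-p')` is `∞`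
where `w` vanishes; `p'` is the conjugate exponent of `p`. -/
def IsApq (μ : Measure X) (p q : ℝ) (w : X → ℝ) : Prop :=
  IsWeight μ w ∧ ∃ C : ℝ≥0,
    (1 < p ∧ ∀ (x : X) (r : ℝ), 0 < r →
      (⨍⁻ y in ball x r, ENNReal.ofReal (w y) ^ q ∂μ) ^ (1 / q) *
        (⨍⁻ y in ball x r, ENNReal.ofReal (w y) ^ (-p.conjExponent) ∂μ) ^ (1 / p.conjExponent)
          ≤ C) ∨
    (p = 1 ∧ ∀ (x : X) (r : ℝ), 0 < r →
      ∀ᵐ z ∂(μ.restrict (ball x r)),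
        (⨍⁻ y in ball x r, ENNReal.ofReal (w y) ^ q ∂μ) ^ (1 / q) ≤ C * ENNReal.ofReal (w z))

/-- The (uncentred) fractional maximal function
`M_α f (x) = sup_{B ∋ x} r(B)^α ⨍_B |f| dμ`. -/
noncomputable def fracMaximal (μ : Measure X) (α : ℝ) (f : X → ℂ) (x : X) : ℝ≥0∞ :=
  ⨆ (z : X) (r : ℝ) (_ : 0 < r) (_ : x ∈ ball z r),
    ENNReal.ofReal (r ^ α) * ⨍⁻ y in ball z r, ‖f y‖ₑ ∂μ

/-- The measure `v dμ`, for a non-negative function `v`. -/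
noncomputable def weightedMeasure (μ : Measure X) (v : X → ℝ) : Measure X :=
  μ.withDensity (fun x => ENNReal.ofReal (v x))

/-- The weak-type quasi-norm `sup_{t > 0} t ν{g > t}^{1/q}` of `L^{q,∞}(ν)`. -/
noncomputable def weakLpNorm {Y : Type*} [MeasurableSpace Y] (g : Y → ℝ≥0∞) (q : ℝ)
    (ν : Measure Y) : ℝ≥0∞ :=
  ⨆ t : ℝ≥0, (t : ℝ≥0∞) * ν {x | (t : ℝ≥0∞) < g x} ^ (1 / q)

/-- Membership in the weak Lebesgue space `L^{q,∞}(ν)`. -/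
def MemWeakLp {Y : Type*} [MeasurableSpace Y] (g : Y → ℝ≥0∞) (q : ℝ) (ν : Measure Y) : Prop :=
  AEStronglyMeasurable g ν ∧ weakLpNorm g q ν < ∞

end HomogeneousType

/-! The growth bound gives `r(B)^α ≤ c^(-α/n) μ(B)^(α/n)`, so `M_α` is dominated by the maximal
operator of order `α/n` normalized by powers of `μ(B)`. Everything else concerns that operator.

For `p > 1` put `U = w^q`, `S = w^(-p')`, `r = 1 + p'/q` and `g = F/S`. By Hölder and `A_{p,q}`,
`U(B)^(1/q) S(B)^(1/p')` is comparable to `μ(B)^(1/q + 1/p')`, and this makes both `U dμ` and `S dμ`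
doubling. No reverse Hölder inequality or good-λ argument is needed: on a single ball the hypotheses
interpolate (`rpow_mul_le_of_average_bounds`) to the pointwise bound `(M_{α/n} F)^q ≤ const · G^(q/p
- 1) · (M_U (U⁻¹ (M_S g)^(p/r)))^r`, with `G = ∫ g^p S dμ`. Since `U^(1-r) = S`, the
Hardy–Littlewood theorem in `L^r(U)` followed by the one in `L^p(S)` bounds the integral of the
right side against `U` by `G^(q/p)`.

For `p = 1` the `A_{1,q}` condition makes `w^q dμ` doubling and turns `M_{α/n} F > t` into `t
ν(B)^(1/q) ≤ C ∫_B F w dμ` with `ν = w^q dμ`; the Vitali covering estimate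
`exists_rpow_mul_measure_le` concludes.

Since `0 · ∞ = 0`, a weight vanishing a.e. is admissible. A weight is shown to vanish either a.e. or
almost nowhere, and the first case is trivial. -/

namespace HomogeneousType

variable {X : Type*} [MetricSpace X]

/-! ### Suprema over balls and basic facts on doubling measures -/

/-- The supremum of a functional of balls over the balls containing a given point. -/
noncomputable def ballSup (Φ : X → ℝ → ℝ≥0∞) (x : X) : ℝ≥0∞ :=
  ⨆ (z : X) (r : ℝ) (_ : 0 < r) (_ : x ∈ ball z r), Φ z r

lemma le_ballSup (Φ : X → ℝ → ℝ≥0∞) {x z : X} {r : ℝ} (hr : 0 < r) (hx : x ∈ ball z r) :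
    Φ z r ≤ ballSup Φ x :=
  le_iSup_of_le z (le_iSup_of_le r (le_iSup_of_le hr (le_iSup_of_le hx le_rfl)))

lemma ballSup_le {Φ : X → ℝ → ℝ≥0∞} {x : X} {a : ℝ≥0∞}
    (h : ∀ z r, 0 < r → x ∈ ball z r → Φ z r ≤ a) : ballSup Φ x ≤ a :=
  iSup_le fun z => iSup_le fun r => iSup_le fun hr => iSup_le fun hx => h z r hr hx

lemma lt_ballSup_iff {Φ : X → ℝ → ℝ≥0∞} {x : X} {a : ℝ≥0∞} :
    a < ballSup Φ x ↔ ∃ z r, 0 < r ∧ x ∈ ball z r ∧ a < Φ z r := by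
  simp only [ballSup, lt_iSup_iff, exists_prop]

/-- The witnessing ball serves all of its points, so superlevel sets are unions of open balls;
measurability of uncentred maximal functions then needs nothing of the functional. -/
lemma isOpen_lt_ballSup (Φ : X → ℝ → ℝ≥0∞) (a : ℝ≥0∞) : IsOpen {x | a < ballSup Φ x} := by
  rw [isOpen_iff_forall_mem_open]
  intro x hx
  obtain ⟨z, r, hr, hxz, ha⟩ := lt_ballSup_iff.1 hx
  exact ⟨ball z r, fun y hy => lt_ballSup_iff.2 ⟨z, r, hr, hy, ha⟩, isOpen_ball, hxz⟩

variable [MeasurableSpace X]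

lemma measurable_ballSup [BorelSpace X] (Φ : X → ℝ → ℝ≥0∞) : Measurable (ballSup Φ) :=
  measurable_of_Ioi fun a => (isOpen_lt_ballSup Φ a).measurableSet

/-- The uncentred maximal function of order `γ` of a measure `μ`, normalized by powers of the
measure of the balls. -/
noncomputable def ballMaximal (μ : Measure X) (γ : ℝ) (F : X → ℝ≥0∞) : X → ℝ≥0∞ :=
  ballSup fun z r => μ (ball z r) ^ (γ - 1) * ∫⁻ y in ball z r, F y ∂μ

lemma ballMaximal_congr_ae {μ : Measure X} {F G : X → ℝ≥0∞} (h : F =ᵐ[μ] G) (γ : ℝ) :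
    ballMaximal μ γ F = ballMaximal μ γ G := by
  unfold ballMaximal
  congr! 4 with z r
  exact lintegral_congr_ae (ae_restrict_of_ae h)

namespace IsDoubling

variable {μ : Measure X}

lemma measure_ball_ne_zero (hμ : IsDoubling μ) (x : X) {r : ℝ} (hr : 0 < r) :
    μ (ball x r) ≠ 0 := (hμ.measure_ball_pos x r hr).ne'

lemma measure_ball_ne_top (hμ : IsDoubling μ) (x : X) {r : ℝ} (hr : 0 < r) :
    μ (ball x r) ≠ ∞ := (hμ.measure_ball_lt_top x r hr).ne

lemma sigmaFinite (hμ : IsDoubling μ) : SigmaFinite μ := by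
  rcases isEmpty_or_nonempty X with h | ⟨⟨x₀⟩⟩
  · rw [Measure.eq_zero_of_isEmpty μ]; infer_instance
  · refine ⟨⟨⟨fun k => ball x₀ (k + 1), fun _ => trivial, fun k =>
      hμ.measure_ball_lt_top _ _ (by positivity), ?_⟩⟩⟩
    refine Set.eq_univ_of_forall fun x => Set.mem_iUnion.2 ?_
    obtain ⟨k, hk⟩ := exists_nat_gt (dist x x₀)
    exact ⟨k, by rw [mem_ball]; linarith⟩

lemma measure_ball_eight_mul (hμ : IsDoubling μ) :
    ∃ D : ℝ≥0, ∀ (x : X) (r : ℝ), 0 < r → μ (ball x (8 * r)) ≤ D * μ (ball x r) := by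
  obtain ⟨D, hD⟩ := hμ.doubling
  refine ⟨D * (D * D), fun x r hr => ?_⟩
  calc μ (ball x (8 * r)) = μ (ball x (2 * (2 * (2 * r)))) := by ring_nf
    _ ≤ D * (D * (D * μ (ball x r))) := by
      refine (hD x _ (by positivity)).trans ?_
      gcongr
      refine (hD x _ (by positivity)).trans ?_
      gcongr
      exact hD x _ hr
    _ = _ := by push_cast; ring

end IsDoubling

/-! ### Vitali covering estimate -/

lemma tsum_rpow_le_rpow_tsum {ι : Type*} (a : ι → ℝ≥0∞) {q : ℝ} (hq : 1 ≤ q) :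
    ∑' i, a i ^ q ≤ (∑' i, a i) ^ q := by
  calc ∑' i, a i ^ q ≤ ∑' i, a i * (∑' j, a j) ^ (q - 1) := by
        refine ENNReal.tsum_le_tsum fun i => ?_
        calc a i ^ q = a i ^ (1 + (q - 1)) := by ring_nf
          _ = a i * a i ^ (q - 1) := by
            rw [ENNReal.rpow_add_of_nonneg _ _ zero_le_one (by linarith), ENNReal.rpow_one]
          _ ≤ _ := by gcongr; exact ENNReal.le_tsum i
    _ = (∑' j, a j) ^ (1 + (q - 1)) := by
        rw [ENNReal.tsum_mul_right, ENNReal.rpow_add_of_nonneg _ _ zero_le_one (by linarith),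
          ENNReal.rpow_one]
    _ = _ := by ring_nf

/-- Weak type estimate: a set covered by balls `B` with `t ν(B)^{1/q} ≤ κ(B)` is small. -/
theorem IsDoubling.exists_rpow_mul_measure_le [BorelSpace X] {ν : Measure X} (hν : IsDoubling ν)
    {q : ℝ} (hq : 1 ≤ q) :
    ∃ K : ℝ≥0, ∀ (κ : Measure X) (t : ℝ≥0∞) (E : Set X),
      (∀ x ∈ E, ∃ z r, 0 < r ∧ x ∈ ball z r ∧ t * ν (ball z r) ^ (1 / q) ≤ κ (ball z r)) →
        t ^ q * ν E ≤ K * κ Set.univ ^ q := by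
  obtain ⟨D, hD⟩ := hν.measure_ball_eight_mul
  have hq0 : 0 < q := by linarith
  have := hν.sigmaFinite
  refine ⟨D, fun κ t E hE => ?_⟩
  -- Vitali selection needs bounded radii; the truncation at `k` is removed at the end by monotone
  -- convergence.
  let S : ℕ → Set X := fun k => {x | ∃ (z : X) (r : ℝ), 0 < r ∧ r ≤ k ∧ x ∈ ball z r ∧
    t * ν (ball z r) ^ (1 / q) ≤ κ (ball z r)}
  have hSmono : Monotone S := by
    rintro k l hkl x ⟨z, r, hr, hrk, h⟩
    exact ⟨z, r, hr, hrk.trans (by exact_mod_cast hkl), h⟩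
  have hES : E ⊆ ⋃ k, S k := by
    intro x hx
    obtain ⟨z, r, hr, h⟩ := hE x hx
    obtain ⟨k, hk⟩ := exists_nat_ge r
    exact Set.mem_iUnion.2 ⟨k, z, r, hr, hk, h⟩
  have key : ∀ k, t ^ q * ν (S k) ≤ D * κ Set.univ ^ q := by
    intro k
    let T : Set (X × ℝ) := {b | 0 < b.2 ∧ b.2 ≤ k ∧
      t * ν (ball b.1 b.2) ^ (1 / q) ≤ κ (ball b.1 b.2)}
    obtain ⟨u, huT, hdisj, hcov⟩ := Vitali.exists_disjoint_subfamily_covering_enlargement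
      (fun b : X × ℝ => ball b.1 b.2) T (fun b => b.2) 2 one_lt_two (fun b hb => hb.1.le) k
      (fun b hb => hb.2.1) (fun b hb => ⟨b.1, mem_ball_self hb.1⟩)
    have hdisj' : Pairwise (Function.onFun Disjoint fun b : u => ball b.1.1 b.1.2) :=
      fun a b hab => hdisj a.2 b.2 (fun h => hab (Subtype.ext h))
    -- Disjoint sets of positive measure are countably many, `ν` being σ-finite.
    have hcount : Countable u := by
      have := Measure.countable_meas_pos_of_disjoint_iUnion (μ := ν)
        (fun b : u => measurableSet_ball (x := b.1.1) (ε := b.1.2)) hdisj'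
      have huniv : {b : u | 0 < ν (ball b.1.1 b.1.2)} = Set.univ :=
        Set.eq_univ_of_forall fun b => hν.measure_ball_pos _ _ (huT b.2).1
      rw [huniv] at this
      exact Set.countable_univ_iff.1 this
    -- The selected ball has at least half the radius, so dilation by 5 suffices; 8 is the next
    -- power of 2.
    have hsub : S k ⊆ ⋃ b : u, ball b.1.1 (8 * b.1.2) := by
      rintro x ⟨z, r, hr, hrk, hxz, h⟩
      obtain ⟨b, hb, ⟨y, hya, hyb⟩, hδ⟩ := hcov (z, r) ⟨hr, hrk, h⟩
      refine Set.mem_iUnion.2 ⟨⟨b, hb⟩, ?_⟩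
      simp only [mem_ball] at *
      have h1 := dist_triangle x z b.1
      have h2 := dist_triangle z y b.1
      rw [dist_comm z y] at h2
      have := (huT hb).1
      linarith
    calc t ^ q * ν (S k) ≤ t ^ q * ∑' b : u, D * ν (ball b.1.1 b.1.2) := by
          gcongr
          refine (measure_mono hsub).trans ((measure_iUnion_le _).trans ?_)
          exact ENNReal.tsum_le_tsum fun b => hD _ _ (huT b.2).1
      _ = D * ∑' b : u, (t * ν (ball b.1.1 b.1.2) ^ (1 / q)) ^ q := by
          rw [ENNReal.tsum_mul_left, mul_left_comm, ← ENNReal.tsum_mul_left]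
          congr 2 with b
          rw [ENNReal.mul_rpow_of_nonneg _ _ hq0.le, ← ENNReal.rpow_mul,
            one_div_mul_cancel hq0.ne', ENNReal.rpow_one]
      _ ≤ D * ∑' b : u, κ (ball b.1.1 b.1.2) ^ q := by
          gcongr with b
          exact (huT b.2).2.2
      _ ≤ D * (∑' b : u, κ (ball b.1.1 b.1.2)) ^ q := by
          gcongr
          exact tsum_rpow_le_rpow_tsum _ hq
      _ ≤ D * κ Set.univ ^ q := by
          rw [← measure_iUnion hdisj' fun b => measurableSet_ball]
          gcongr
          exact Set.subset_univ _
  calc t ^ q * ν E ≤ t ^ q * ν (⋃ k, S k) := by gcongr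
    _ = ⨆ k, t ^ q * ν (S k) := by
      rw [hSmono.measure_iUnion, ENNReal.mul_iSup]
    _ ≤ _ := iSup_le key

/-! ### Layer-cake formula and the Hardy–Littlewood theorem -/

lemma lintegral_Ioi_ite_rpow_of_ne_top {s : ℝ} (hs : 0 < s) {a : ℝ≥0∞} (ha : a ≠ ∞) :
    ∫⁻ t : ℝ in Set.Ioi (0 : ℝ), (if ENNReal.ofReal t < a then ENNReal.ofReal (t ^ (s - 1)) else 0)
      = a ^ s / ENNReal.ofReal s := by
  lift a to ℝ≥0 using ha
  have h1 : ∀ t ∈ Set.Ioi (0 : ℝ),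
      (if ENNReal.ofReal t < a then ENNReal.ofReal (t ^ (s - 1)) else 0)
      = (Set.Ioo 0 (a : ℝ)).indicator (fun t => ENNReal.ofReal (t ^ (s - 1))) t := by
    intro t ht
    have : ENNReal.ofReal t < a ↔ t ∈ Set.Ioo 0 (a : ℝ) := by
      rw [← ENNReal.ofReal_coe_nnreal, ENNReal.ofReal_lt_ofReal_iff_of_nonneg (le_of_lt ht)]
      exact ⟨fun h => ⟨ht, h⟩, fun h => h.2⟩
    simp only [Set.indicator, this]
  rw [setLIntegral_congr_fun measurableSet_Ioi h1, lintegral_indicator measurableSet_Ioo,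
    Measure.restrict_restrict measurableSet_Ioo,
    Set.inter_eq_left.2 (Set.Ioo_subset_Ioi_self : Set.Ioo 0 (a : ℝ) ⊆ Set.Ioi 0),
    setLIntegral_congr Ioo_ae_eq_Ioc]
  have hint : IntegrableOn (fun t : ℝ => t ^ (s - 1)) (Set.Ioc 0 (a : ℝ)) := by
    rw [← intervalIntegrable_iff_integrableOn_Ioc_of_le a.coe_nonneg]
    exact intervalIntegral.intervalIntegrable_rpow' (by linarith)
  rw [← ofReal_integral_eq_lintegral_ofReal hint
    ((ae_restrict_mem measurableSet_Ioc).mono fun t ht => Real.rpow_nonneg ht.1.le _),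
    ← intervalIntegral.integral_of_le a.coe_nonneg, integral_rpow (Or.inl (by linarith))]
  rw [sub_add_cancel, Real.zero_rpow hs.ne', sub_zero, ENNReal.ofReal_div_of_pos hs,
    ← ENNReal.ofReal_rpow_of_nonneg a.coe_nonneg hs.le, ENNReal.ofReal_coe_nnreal]

lemma lintegral_Ioi_ite_rpow {s : ℝ} (hs : 0 < s) (a : ℝ≥0∞) :
    ∫⁻ t : ℝ in Set.Ioi (0 : ℝ), (if ENNReal.ofReal t < a then ENNReal.ofReal (t ^ (s - 1)) else 0)
      = a ^ s / ENNReal.ofReal s := by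
  rcases eq_or_ne a ∞ with rfl | ha
  · rw [ENNReal.top_rpow_of_pos hs, ENNReal.top_div_of_ne_top ENNReal.ofReal_ne_top]
    -- The finite level `(b s)^(1/s)` has integral exactly `b`, a lower bound for the integral at
    -- level `∞`.
    refine ENNReal.eq_top_of_forall_nnreal_le fun b => ?_
    have hs' : ENNReal.ofReal s ≠ 0 := by simpa using hs
    have hc : ((b : ℝ≥0∞) * ENNReal.ofReal s) ^ s⁻¹ ≠ ∞ :=
      ENNReal.rpow_ne_top_of_nonneg (by positivity)
        (ENNReal.mul_ne_top ENNReal.coe_ne_top ENNReal.ofReal_ne_top)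
    have h := lintegral_Ioi_ite_rpow_of_ne_top hs hc
    rw [← ENNReal.rpow_mul, inv_mul_cancel₀ hs.ne', ENNReal.rpow_one,
      ENNReal.mul_div_cancel_right hs' ENNReal.ofReal_ne_top] at h
    rw [← h]
    refine lintegral_mono fun t => ?_
    split_ifs with h1 h2 <;> simp_all
  · exact lintegral_Ioi_ite_rpow_of_ne_top hs ha

lemma measurable_ite_ofReal_lt {α : Type*} [MeasurableSpace α] {G : α → ℝ≥0∞}
    (hG : Measurable G) {H : α × ℝ → ℝ≥0∞} (hH : Measurable H) :
    Measurable fun z : α × ℝ => if ENNReal.ofReal z.2 < G z.1 then H z else 0 :=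
  Measurable.ite (measurableSet_lt (by fun_prop) (by fun_prop)) hH measurable_const

/-- Only the part of `g` above height `t` matters: if the average of `g` exceeds `2t`, the part
below `t` contributes at most `t`, so the rest averages at least `t`. The covering estimate with
exponent 1 applies to that part. -/
lemma IsDoubling.exists_mul_measure_lt_ballMaximal_le [BorelSpace X] {ν : Measure X}
    (hν : IsDoubling ν) : ∃ K : ℝ≥0, ∀ g : X → ℝ≥0∞, Measurable g → ∀ t : ℝ≥0∞, t ≠ ∞ →
      t * ν {x | t < ballMaximal ν 0 g x / 2} ≤ K * ∫⁻ x, (if t < g x then g x else 0) ∂ν := by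
  obtain ⟨K, hK⟩ := hν.exists_rpow_mul_measure_le le_rfl
  refine ⟨K, fun g hg t ht => ?_⟩
  have := hK (ν.withDensity fun x => if t < g x then g x else 0) t
    {x | t < ballMaximal ν 0 g x / 2} ?_
  · simpa using this
  intro x hx
  have hx' : t * 2 < ballMaximal ν 0 g x := by
    rwa [Set.mem_ofPred_eq, ENNReal.lt_div_iff_mul_lt (by simp) (by simp)] at hx
  obtain ⟨z, r, hr, hxz, h⟩ := lt_ballSup_iff.1 hx'
  refine ⟨z, r, hr, hxz, ?_⟩
  have hm0 := hν.measure_ball_ne_zero z hr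
  have hmt := hν.measure_ball_ne_top z hr
  rw [withDensity_apply _ measurableSet_ball, div_one, ENNReal.rpow_one]
  rw [zero_sub, ENNReal.rpow_neg_one, mul_comm (_⁻¹), ← div_eq_mul_inv,
    ENNReal.lt_div_iff_mul_lt (.inl hm0) (.inl hmt)] at h
  have hle : ∫⁻ y in ball z r, g y ∂ν
      ≤ t * ν (ball z r) + ∫⁻ y in ball z r, (if t < g y then g y else 0) ∂ν := by
    rw [← setLIntegral_const, ← lintegral_add_left measurable_const]
    refine lintegral_mono fun y => ?_
    split_ifs with hy
    · exact le_add_self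
    · simpa using hy
  have h2 : t * ν (ball z r) + t * ν (ball z r) ≤
      t * ν (ball z r) + ∫⁻ y in ball z r, (if t < g y then g y else 0) ∂ν := by
    refine le_trans (le_of_eq ?_) (h.le.trans hle)
    ring
  exact (ENNReal.add_le_add_iff_left (ENNReal.mul_ne_top ht hmt)).1 h2

/-- The Hardy–Littlewood maximal theorem for a doubling measure. -/
theorem IsDoubling.exists_lintegral_ballMaximal_rpow_le [BorelSpace X] {ν : Measure X}
    (hν : IsDoubling ν) {p : ℝ} (hp : 1 < p) :
    ∃ K : ℝ≥0, ∀ g : X → ℝ≥0∞, AEMeasurable g ν →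
      ∫⁻ x, ballMaximal ν 0 g x ^ p ∂ν ≤ K * ∫⁻ x, g x ^ p ∂ν := by
  obtain ⟨K, hK⟩ := hν.exists_mul_measure_lt_ballMaximal_le
  have := hν.sigmaFinite
  have hp0 : 0 < p := by linarith
  have hp1 : 0 < p - 1 := by linarith
  suffices h : ∃ K' : ℝ≥0∞, K' ≠ ∞ ∧ ∀ g : X → ℝ≥0∞, Measurable g →
      ∫⁻ x, ballMaximal ν 0 g x ^ p ∂ν ≤ K' * ∫⁻ x, g x ^ p ∂ν by
    obtain ⟨K', hK't, hK'⟩ := h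
    lift K' to ℝ≥0 using hK't
    refine ⟨K', fun g hg => ?_⟩
    have e : ∫⁻ x, g x ^ p ∂ν = ∫⁻ x, hg.mk g x ^ p ∂ν :=
      lintegral_congr_ae (hg.ae_eq_mk.fun_comp (· ^ p))
    rw [ballMaximal_congr_ae hg.ae_eq_mk, e]
    exact hK' _ hg.measurable_mk
  -- The factors come from halving the maximal function, the layer-cake formula, the weak-type
  -- bound, and `∫_0^g t^(p-2) dt = g^(p-1)/(p-1)`.
  refine ⟨2 ^ p * (ENNReal.ofReal p * (K * (ENNReal.ofReal (p - 1))⁻¹)), ?_, fun g hg => ?_⟩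
  · have : (ENNReal.ofReal (p - 1))⁻¹ ≠ ∞ := by simpa using hp
    have : (2 : ℝ≥0∞) ^ p ≠ ∞ := ENNReal.rpow_ne_top_of_nonneg hp0.le (by simp)
    finiteness
  set G : X → ℝ≥0∞ := fun x => ballMaximal ν 0 g x / 2 with hG
  have hGm : Measurable G := (measurable_ballSup _).div_const 2
  have e1 : ∀ x, ballMaximal ν 0 g x ^ p = 2 ^ p * (ENNReal.ofReal p *
      ∫⁻ t : ℝ in Set.Ioi (0 : ℝ),
        (if ENNReal.ofReal t < G x then ENNReal.ofReal (t ^ (p - 1)) else 0)) := by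
    intro x
    rw [lintegral_Ioi_ite_rpow hp0, ENNReal.mul_div_cancel (by simpa using hp0) (by simp),
      ← ENNReal.mul_rpow_of_nonneg _ _ hp0.le, hG, ENNReal.mul_div_cancel (by simp) (by simp)]
  have hm1 : Measurable fun z : X × ℝ =>
      if ENNReal.ofReal z.2 < G z.1 then ENNReal.ofReal (z.2 ^ (p - 1)) else 0 :=
    measurable_ite_ofReal_lt hGm (by fun_prop)
  have hm2 : Measurable fun z : X × ℝ =>
      if ENNReal.ofReal z.2 < g z.1 then ENNReal.ofReal (z.2 ^ (p - 1 - 1)) * g z.1 else 0 :=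
    measurable_ite_ofReal_lt hg (by fun_prop)
  calc ∫⁻ x, ballMaximal ν 0 g x ^ p ∂ν
      = 2 ^ p * (ENNReal.ofReal p * ∫⁻ x, ∫⁻ t : ℝ in Set.Ioi (0 : ℝ),
        (if ENNReal.ofReal t < G x then ENNReal.ofReal (t ^ (p - 1)) else 0) ∂volume ∂ν) := by
        simp_rw [e1]
        rw [lintegral_const_mul _ (hm1.lintegral_prod_right'.const_mul _),
          lintegral_const_mul _ hm1.lintegral_prod_right']
    _ = 2 ^ p * (ENNReal.ofReal p * ∫⁻ t : ℝ in Set.Ioi (0 : ℝ), ∫⁻ x,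
        (if ENNReal.ofReal t < G x then ENNReal.ofReal (t ^ (p - 1)) else 0) ∂ν) := by
        rw [lintegral_lintegral_swap hm1.aemeasurable]
    _ ≤ 2 ^ p * (ENNReal.ofReal p * ∫⁻ t : ℝ in Set.Ioi (0 : ℝ), K * ∫⁻ x,
        (if ENNReal.ofReal t < g x then ENNReal.ofReal (t ^ (p - 1 - 1)) * g x else 0) ∂ν) := by
        gcongr 2 ^ p * (ENNReal.ofReal p * ?_)
        refine setLIntegral_mono' measurableSet_Ioi fun t ht => ?_
        have ht0 : 0 < t := ht
        have e2 : ∀ x, (if ENNReal.ofReal t < G x then ENNReal.ofReal (t ^ (p - 1)) else 0)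
            = {x | ENNReal.ofReal t < G x}.indicator
              (fun _ => ENNReal.ofReal (t ^ (p - 1))) x := fun x => by
          simp only [Set.indicator, Set.mem_ofPred_eq]
        have e3 : ∀ x,
            (if ENNReal.ofReal t < g x then ENNReal.ofReal (t ^ (p - 1 - 1)) * g x else 0)
            = ENNReal.ofReal (t ^ (p - 1 - 1)) * (if ENNReal.ofReal t < g x then g x else 0) := by
          intro x; split_ifs <;> simp
        simp_rw [e2, e3]
        rw [lintegral_indicator_const (measurableSet_lt measurable_const hGm),
          lintegral_const_mul _ (Measurable.ite (measurableSet_lt measurable_const hg) hg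
            measurable_const)]
        calc ENNReal.ofReal (t ^ (p - 1)) * ν {x | ENNReal.ofReal t < G x}
            = ENNReal.ofReal (t ^ (p - 1 - 1)) *
              (ENNReal.ofReal t * ν {x | ENNReal.ofReal t < G x}) := by
              rw [← mul_assoc, ← ENNReal.ofReal_mul (by positivity),
                ← Real.rpow_add_one ht0.ne', sub_add_cancel]
          _ ≤ ENNReal.ofReal (t ^ (p - 1 - 1)) *
              (K * ∫⁻ x, (if ENNReal.ofReal t < g x then g x else 0) ∂ν) := by
              gcongr ENNReal.ofReal (t ^ (p - 1 - 1)) * ?_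
              exact hK g hg _ ENNReal.ofReal_ne_top
          _ = _ := by ring
    _ = 2 ^ p * (ENNReal.ofReal p * (K * ∫⁻ x, ∫⁻ t : ℝ in Set.Ioi (0 : ℝ),
        (if ENNReal.ofReal t < g x then ENNReal.ofReal (t ^ (p - 1 - 1)) * g x else 0) ∂volume ∂ν)) := by
        rw [lintegral_const_mul _ hm2.lintegral_prod_left', 
          lintegral_lintegral_swap (f := fun x t => if ENNReal.ofReal t < g x then
            ENNReal.ofReal (t ^ (p - 1 - 1)) * g x else 0) hm2.aemeasurable]
    _ = 2 ^ p * (ENNReal.ofReal p * (K * ∫⁻ x, g x ^ p * (ENNReal.ofReal (p - 1))⁻¹ ∂ν)) := by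
        congr 4 with x
        have e3 : ∀ t : ℝ,
            (if ENNReal.ofReal t < g x then ENNReal.ofReal (t ^ (p - 1 - 1)) * g x else 0)
            = (if ENNReal.ofReal t < g x then ENNReal.ofReal (t ^ (p - 1 - 1)) else 0) * g x := by
          intro x; split_ifs <;> simp
        simp_rw [e3]
        rw [lintegral_mul_const _ (Measurable.ite (measurableSet_lt (by fun_prop) measurable_const)
          (by fun_prop) measurable_const), lintegral_Ioi_ite_rpow hp1, div_eq_mul_inv,
          mul_right_comm]
        congr 1
        nth_rewrite 2 [← ENNReal.rpow_one (g x)]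
        rw [← ENNReal.rpow_add_of_nonneg _ _ hp1.le zero_le_one, sub_add_cancel]
    _ = _ := by
        rw [lintegral_mul_const _ (hg.pow_const p)]
        ring

end HomogeneousType

namespace HomogeneousType

/-! ### Pairs of Muckenhoupt densities -/

lemma setLIntegral_withDensity {α : Type*} [MeasurableSpace α] {μ : Measure α}
    {U f : α → ℝ≥0∞} (hU : AEMeasurable U μ)
    (hf : AEMeasurable f μ) {s : Set α} (hs : MeasurableSet s) :
    ∫⁻ x in s, f x ∂(μ.withDensity U) = ∫⁻ x in s, U x * f x ∂μ := by
  rw [restrict_withDensity hs, lintegral_withDensity_eq_lintegral_mul₀ hU.restrict hf.restrict]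
  rfl

variable {X : Type*} [MetricSpace X] [MeasurableSpace X]

lemma lintegral_div_measure_le_ballMaximal (μ : Measure X) (F : X → ℝ≥0∞) {x z : X} {r : ℝ}
    (hr : 0 < r) (hx : x ∈ ball z r) :
    (∫⁻ y in ball z r, F y ∂μ) / μ (ball z r) ≤ ballMaximal μ 0 F x := by
  refine le_trans (le_of_eq ?_) (le_ballSup (fun z r => μ (ball z r) ^ ((0 : ℝ) - 1) *
    ∫⁻ y in ball z r, F y ∂μ) hr hx)
  rw [zero_sub, ENNReal.rpow_neg_one, mul_comm, ← div_eq_mul_inv]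

/-- Two densities `U`, `S` with `U ^ a * S ^ b = 1` and
`U(B) ^ a * S(B) ^ b ≤ C * μ(B) ^ (a + b)` for all balls `B`. -/
structure IsMuckenhouptPair (μ : Measure X) (a b : ℝ) (U S : X → ℝ≥0∞) : Prop where
  left_pos : 0 < a
  right_pos : 0 < b
  aemeasurable_left : AEMeasurable U μ
  aemeasurable_right : AEMeasurable S μ
  mul_eq_one : ∀ᵐ x ∂μ, U x ^ a * S x ^ b = 1
  bound : ∃ C : ℝ≥0, ∀ (x : X) (r : ℝ), 0 < r →
    (μ.withDensity U (ball x r)) ^ a * (μ.withDensity S (ball x r)) ^ b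
      ≤ C * μ (ball x r) ^ (a + b)

lemma withDensity_measure_ball_ne_zero [BorelSpace X] {μ : Measure X} (hμ : IsDoubling μ)
    {U : X → ℝ≥0∞} (hU : AEMeasurable U μ) (h0 : ∀ᵐ x ∂μ, U x ≠ 0) (x : X) {r : ℝ} (hr : 0 < r) :
    μ.withDensity U (ball x r) ≠ 0 := by
  rw [Ne, withDensity_apply_eq_zero' hU]
  intro h
  refine hμ.measure_ball_ne_zero x hr (measure_mono_null_ae ?_ h)
  filter_upwards [h0] with y hy hyB using ⟨hy, hyB⟩

namespace IsMuckenhouptPair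

variable {μ : Measure X} {a b : ℝ} {U S : X → ℝ≥0∞}

lemma symm (h : IsMuckenhouptPair μ a b U S) : IsMuckenhouptPair μ b a S U where
  left_pos := h.right_pos
  right_pos := h.left_pos
  aemeasurable_left := h.aemeasurable_right
  aemeasurable_right := h.aemeasurable_left
  mul_eq_one := h.mul_eq_one.mono fun x hx => by rwa [mul_comm]
  bound := by
    obtain ⟨C, hC⟩ := h.bound
    exact ⟨C, fun x r hr => by simpa only [mul_comm, add_comm] using hC x r hr⟩

lemma ae_ne_zero (h : IsMuckenhouptPair μ a b U S) : ∀ᵐ x ∂μ, U x ≠ 0 := by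
  filter_upwards [h.mul_eq_one] with x hx h0
  simp [h0, ENNReal.zero_rpow_of_pos h.left_pos] at hx

lemma ae_ne_top (h : IsMuckenhouptPair μ a b U S) : ∀ᵐ x ∂μ, U x ≠ ∞ := by
  filter_upwards [h.mul_eq_one, h.symm.ae_ne_zero] with x hx h0 ht
  have : S x ^ b ≠ 0 := by simp [ENNReal.rpow_eq_zero_iff, h0, h.right_pos.not_gt]
  simp [ht, ENNReal.top_rpow_of_pos h.left_pos, ENNReal.top_mul this] at hx

lemma ae_eq_rpow (h : IsMuckenhouptPair μ a b U S) : ∀ᵐ x ∂μ, S x = U x ^ (-(a / b)) := by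
  filter_upwards [h.mul_eq_one] with x hx
  have h1 : S x ^ b = (U x ^ a)⁻¹ := ENNReal.eq_inv_of_mul_eq_one_left (by rwa [mul_comm])
  calc S x = (S x ^ b) ^ b⁻¹ := by
        rw [← ENNReal.rpow_mul, mul_inv_cancel₀ h.right_pos.ne', ENNReal.rpow_one]
    _ = _ := by
        rw [h1, ← ENNReal.rpow_neg, ← ENNReal.rpow_mul]
        congr 1
        ring

variable [BorelSpace X]

lemma measure_ball_ne_zero (h : IsMuckenhouptPair μ a b U S) (hμ : IsDoubling μ) (x : X) {r : ℝ}
    (hr : 0 < r) : μ.withDensity U (ball x r) ≠ 0 :=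
  withDensity_measure_ball_ne_zero hμ h.aemeasurable_left h.ae_ne_zero x hr

lemma measure_ball_ne_top (h : IsMuckenhouptPair μ a b U S) (hμ : IsDoubling μ) (x : X) {r : ℝ}
    (hr : 0 < r) : μ.withDensity U (ball x r) ≠ ∞ := by
  intro ht
  obtain ⟨C, hC⟩ := h.bound
  have h1 := hC x r hr
  have hs : (μ.withDensity S (ball x r)) ^ b ≠ 0 := by
    simp [ENNReal.rpow_eq_zero_iff, h.symm.measure_ball_ne_zero hμ x hr, h.right_pos.not_gt]
  rw [ht, ENNReal.top_rpow_of_pos h.left_pos, ENNReal.top_mul hs, top_le_iff] at h1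
  exact ENNReal.mul_ne_top ENNReal.coe_ne_top (ENNReal.rpow_ne_top_of_nonneg
    (add_pos h.left_pos h.right_pos).le (hμ.measure_ball_ne_top x hr)) h1

/-- Hölder with exponents `a/(a+b)` and `b/(a+b)`, applied to the product that is 1 a.e.; this is
the converse of `bound`. -/
lemma rpow_measure_ball_le (h : IsMuckenhouptPair μ a b U S) (x : X) (r : ℝ) :
    μ (ball x r) ^ (a + b) ≤
      (μ.withDensity U (ball x r)) ^ a * (μ.withDensity S (ball x r)) ^ b := by
  have ha := h.left_pos
  have hb := h.right_pos
  have hab : 0 < a + b := add_pos ha hb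
  rw [withDensity_apply _ measurableSet_ball, withDensity_apply _ measurableSet_ball]
  have h1 := ENNReal.lintegral_mul_norm_pow_le (μ := μ.restrict (ball x r))
    h.aemeasurable_left.restrict h.aemeasurable_right.restrict
    (p := a / (a + b)) (q := b / (a + b)) (by positivity) (by positivity) (by field_simp)
  have h2 : ∫⁻ y in ball x r, U y ^ (a / (a + b)) * S y ^ (b / (a + b)) ∂μ = μ (ball x r) := by
    rw [← setLIntegral_one]
    refine lintegral_congr_ae (ae_restrict_of_ae ?_)
    filter_upwards [h.mul_eq_one] with y hy
    rw [div_eq_mul_inv, div_eq_mul_inv, ENNReal.rpow_mul, ENNReal.rpow_mul,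
      ← ENNReal.mul_rpow_of_nonneg _ _ (by positivity), hy, ENNReal.one_rpow]
  rw [h2] at h1
  calc μ (ball x r) ^ (a + b) ≤ _ := ENNReal.rpow_le_rpow h1 hab.le
    _ = _ := by
      rw [ENNReal.mul_rpow_of_nonneg _ _ hab.le, ← ENNReal.rpow_mul, ← ENNReal.rpow_mul,
        div_mul_cancel₀ _ hab.ne', div_mul_cancel₀ _ hab.ne']

/-- Apply `bound` on the double ball, doubling of `μ`, then Hölder on the small ball, enlarging only
the ball in the `S` factor. The common factor `S(2B)^b` is nonzero and finite, hence cancels. -/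
theorem isDoubling (h : IsMuckenhouptPair μ a b U S) (hμ : IsDoubling μ) :
    IsDoubling (μ.withDensity U) := by
  have ha := h.left_pos
  have hb := h.right_pos
  obtain ⟨D, hD⟩ := hμ.doubling
  obtain ⟨C, hC⟩ := h.bound
  refine ⟨fun x r hr => pos_iff_ne_zero.2 (h.measure_ball_ne_zero hμ x hr),
    fun x r hr => lt_top_iff_ne_top.2 (h.measure_ball_ne_top hμ x hr),
    (C * D ^ (a + b)) ^ a⁻¹, fun x r hr => ?_⟩
  have hr2 : 0 < 2 * r := by positivity
  set s' := μ.withDensity S (ball x (2 * r)) with hs'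
  have hs0 : s' ^ b ≠ 0 := by
    simp [ENNReal.rpow_eq_zero_iff, h.symm.measure_ball_ne_zero hμ x hr2, s', hb.not_gt]
  have hst : s' ^ b ≠ ∞ :=
    ENNReal.rpow_ne_top_of_nonneg hb.le (h.symm.measure_ball_ne_top hμ x hr2)
  have h1 : s' ^ b * (μ.withDensity U (ball x (2 * r))) ^ a ≤
      s' ^ b * (C * D ^ (a + b) * (μ.withDensity U (ball x r)) ^ a) :=
    calc s' ^ b * (μ.withDensity U (ball x (2 * r))) ^ a
        ≤ C * μ (ball x (2 * r)) ^ (a + b) := by rw [mul_comm]; exact hC x _ hr2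
      _ ≤ C * (D * μ (ball x r)) ^ (a + b) := by gcongr; exact hD x r hr
      _ ≤ C * (D ^ (a + b) * ((μ.withDensity U (ball x r)) ^ a * s' ^ b)) := by
        rw [ENNReal.mul_rpow_of_nonneg _ _ (by positivity)]
        gcongr
        refine (h.rpow_measure_ball_le x r).trans ?_
        gcongr
        exact measure_mono (ball_subset_ball (by linarith))
      _ = _ := by ring
  have h2 := ENNReal.rpow_le_rpow ((ENNReal.mul_le_mul_iff_right hs0 hst).1 h1)
    (inv_nonneg.2 ha.le)
  rw [ENNReal.mul_rpow_of_nonneg _ _ (by positivity), ← ENNReal.rpow_mul, ← ENNReal.rpow_mul,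
    mul_inv_cancel₀ ha.ne', ENNReal.rpow_one, ENNReal.rpow_one] at h2
  refine h2.trans (le_of_eq ?_)
  rw [ENNReal.coe_rpow_of_nonneg _ (inv_nonneg.2 ha.le), ENNReal.coe_mul,
    ENNReal.coe_rpow_of_nonneg _ (by positivity)]

end IsMuckenhouptPair

/-! ### Strong-type estimate -/

/-- Interpolation between two bounds for the average over one ball. -/
lemma rpow_mul_le_of_average_bounds {p p' q : ℝ} (hp : p.HolderConjugate p') (hpq : p < q)
    {m u s I G H C : ℝ≥0∞} (hm0 : m ≠ 0) (hmt : m ≠ ∞) (hu0 : u ≠ 0) (hut : u ≠ ∞)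
    (hs0 : s ≠ 0) (hst : s ≠ ∞)
    (h1 : u ^ (1 / q) * s ^ (1 / p') ≤ C * m ^ (1 / q + 1 / p'))
    (h2 : I ≤ G ^ (1 / p) * s ^ (1 / p'))
    (h3 : (I / s) ^ (p / (1 + p' / q)) * m ≤ H * u) :
    (m ^ (-(1 / q + 1 / p')) * I) ^ q ≤
      C ^ q * C ^ p' * (G ^ (q / p - 1) * H ^ (1 + p' / q)) := by
  have hp0 : 0 < p := hp.pos
  have hp'0 : 0 < p' := hp.symm.pos
  have hq0 : 0 < q := hp0.trans hpq
  have hpp : 1 / p + 1 / p' = 1 := by simpa using hp.inv_add_inv_eq_one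
  set r := 1 + p' / q with hr
  have hr0 : 0 < r := by positivity
  set J := I / s with hJ
  have hI : I = J * s := (ENNReal.div_mul_cancel hs0 hst).symm
  -- `J` is the `S`-average of `g` over the ball; this bound and `hJH` are the two estimates for `J
  -- ^ p` to be interpolated.
  have hJG : s * J ^ p ≤ G := by
    have h4 : J * s ^ (1 / p) ≤ G ^ (1 / p) := by
      have hss : s ^ (1 / p') * s ^ (-(1 / p')) = 1 := by
        rw [← ENNReal.rpow_add _ _ hs0 hst, add_neg_cancel, ENNReal.rpow_zero]
      calc J * s ^ (1 / p) = I * s ^ (-(1 / p')) := by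
            rw [hI, mul_assoc]
            nth_rewrite 2 [← ENNReal.rpow_one s]
            rw [← ENNReal.rpow_add _ _ hs0 hst]
            congr 2
            linarith
        _ ≤ G ^ (1 / p) * s ^ (1 / p') * s ^ (-(1 / p')) := by gcongr
        _ = _ := by rw [mul_assoc, hss, mul_one]
    have h5 := ENNReal.rpow_le_rpow h4 hp0.le
    rw [ENNReal.mul_rpow_of_nonneg _ _ hp0.le, ← ENNReal.rpow_mul, ← ENNReal.rpow_mul,
      one_div_mul_cancel hp0.ne', ENNReal.rpow_one, ENNReal.rpow_one, mul_comm] at h5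
    exact h5
  have hJH : J ^ p ≤ H ^ r * u ^ r * m ^ (-r) := by
    have h4 : J ^ (p / r) ≤ H * u / m := (ENNReal.le_div_iff_mul_le (.inl hm0) (.inl hmt)).2 h3
    calc J ^ p = (J ^ (p / r)) ^ r := by rw [← ENNReal.rpow_mul, div_mul_cancel₀ _ hr0.ne']
      _ ≤ (H * u / m) ^ r := by gcongr
      _ = _ := by
        rw [ENNReal.div_rpow_of_nonneg _ _ hr0.le, ENNReal.mul_rpow_of_nonneg _ _ hr0.le,
          ENNReal.rpow_neg, div_eq_mul_inv]
  have hus : u ^ (p' / q) * s ≤ C ^ p' * m ^ r := by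
    have h4 := ENNReal.rpow_le_rpow h1 hp'0.le
    rw [ENNReal.mul_rpow_of_nonneg _ _ hp'0.le, ENNReal.mul_rpow_of_nonneg _ _ hp'0.le,
      ← ENNReal.rpow_mul, ← ENNReal.rpow_mul, ← ENNReal.rpow_mul, one_div_mul_cancel hp'0.ne',
      ENNReal.rpow_one] at h4
    convert h4 using 3
    · ring
    · rw [hr]; field_simp; ring
  have hm : m ^ (-(1 / q + 1 / p')) * I ≤ C * (u ^ (-(1 / q)) * (s ^ (1 / p) * J)) := by
    have hmm : m ^ (-(1 / q + 1 / p')) * m ^ (1 / q + 1 / p') = 1 := by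
      rw [← ENNReal.rpow_add _ _ hm0 hmt, neg_add_cancel, ENNReal.rpow_zero]
    have huu : u ^ (1 / q) * u ^ (-(1 / q)) = 1 := by
      rw [← ENNReal.rpow_add _ _ hu0 hut, add_neg_cancel, ENNReal.rpow_zero]
    have hsp : s = s ^ (1 / p') * s ^ (1 / p) := by
      rw [← ENNReal.rpow_add _ _ hs0 hst, add_comm, hpp, ENNReal.rpow_one]
    calc m ^ (-(1 / q + 1 / p')) * I
        = m ^ (-(1 / q + 1 / p')) * (u ^ (1 / q) * s ^ (1 / p')) *
          (u ^ (-(1 / q)) * (s ^ (1 / p) * J)) := by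
          rw [hI]
          nth_rewrite 1 [hsp]
          calc _ = m ^ (-(1 / q + 1 / p')) * (J * (s ^ (1 / p') * s ^ (1 / p))) *
                (u ^ (1 / q) * u ^ (-(1 / q))) := by rw [huu, mul_one]
            _ = _ := by ring
      _ ≤ m ^ (-(1 / q + 1 / p')) * (C * m ^ (1 / q + 1 / p')) *
          (u ^ (-(1 / q)) * (s ^ (1 / p) * J)) := by gcongr
      _ = m ^ (-(1 / q + 1 / p')) * m ^ (1 / q + 1 / p') *
          (C * (u ^ (-(1 / q)) * (s ^ (1 / p) * J))) := by ring
      _ = _ := by rw [hmm, one_mul]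
  have hqp : 0 ≤ q / p - 1 := by
    rw [sub_nonneg, one_le_div hp0]
    exact hpq.le
  calc (m ^ (-(1 / q + 1 / p')) * I) ^ q
      ≤ (C * (u ^ (-(1 / q)) * (s ^ (1 / p) * J))) ^ q := by gcongr
    -- Of the `q/p` powers of `s * J ^ p`, `q/p - 1` are bounded through `G` and the last one
    -- through `H`; the leftover `u ^ (r - 1) * s` is absorbed by `hus`.
    _ = C ^ q * (u ^ (-1 : ℝ) * (s * J ^ p) ^ ((q / p - 1) + 1)) := by
        rw [ENNReal.mul_rpow_of_nonneg _ _ hq0.le, ENNReal.mul_rpow_of_nonneg _ _ hq0.le,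
          ENNReal.mul_rpow_of_nonneg _ _ hq0.le, ← ENNReal.rpow_mul, ← ENNReal.rpow_mul,
          sub_add_cancel, ENNReal.mul_rpow_of_nonneg _ _ (by positivity), ← ENNReal.rpow_mul]
        rw [neg_mul, one_div_mul_cancel hq0.ne', one_div_mul_eq_div, mul_div_cancel₀ _ hp0.ne']
    _ = C ^ q * (u ^ (-1 : ℝ) * ((s * J ^ p) ^ (q / p - 1) * (s * J ^ p))) := by
        rw [ENNReal.rpow_add_of_nonneg _ _ hqp zero_le_one, ENNReal.rpow_one]
    _ ≤ C ^ q * (u ^ (-1 : ℝ) * (G ^ (q / p - 1) * (s * (H ^ r * u ^ r * m ^ (-r))))) := by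
        gcongr
    _ = C ^ q * (G ^ (q / p - 1) * H ^ r * (u ^ (-1 : ℝ) * u ^ r * s * m ^ (-r))) := by ring
    _ ≤ C ^ q * (G ^ (q / p - 1) * H ^ r * (C ^ p' * m ^ r * m ^ (-r))) := by
        rw [← ENNReal.rpow_add _ _ hu0 hut, hr, neg_add_cancel_left, ← hr]
        gcongr
    _ = C ^ q * (G ^ (q / p - 1) * H ^ r * C ^ p') := by
        rw [mul_assoc (C ^ p'), ← ENNReal.rpow_add _ _ hm0 hmt, add_neg_cancel,
          ENNReal.rpow_zero, mul_one]
    _ = _ := by ring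

variable [BorelSpace X]

/-- The right side is `G^(q/p)` for `g = F/S`, as `F^p S^(1-p) = g^p S`. The pointwise bound reduces
the claim to two unweighted-type maximal theorems, one for each doubling measure. -/
theorem IsMuckenhouptPair.exists_lintegral_ballMaximal_le {μ : Measure X} (hμ : IsDoubling μ)
    {p p' q : ℝ} (hp : p.HolderConjugate p') (hpq : p < q) {U S : X → ℝ≥0∞}
    (h : IsMuckenhouptPair μ (1 / q) (1 / p') U S) :
    ∃ K : ℝ≥0, ∀ F : X → ℝ≥0∞, AEMeasurable F μ →
      ∫⁻ x, ballMaximal μ (1 - (1 / q + 1 / p')) F x ^ q ∂(μ.withDensity U) ≤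
        K * (∫⁻ x, F x ^ p * S x ^ (1 - p) ∂μ) ^ (q / p) := by
  have hp0 : 0 < p := hp.pos
  have hp'0 : 0 < p' := hp.symm.pos
  have hq0 : 0 < q := hp0.trans hpq
  have hU := h.aemeasurable_left
  have hS := h.aemeasurable_right
  obtain ⟨C, hC⟩ := h.bound
  set r := 1 + p' / q with hr
  have hr1 : 1 < r := by rw [hr, lt_add_iff_pos_right]; positivity
  have hr0 : 0 < r := by linarith
  have hdU := h.isDoubling hμ
  have hdS := h.symm.isDoubling hμ
  obtain ⟨K₁, hK₁⟩ := hdS.exists_lintegral_ballMaximal_rpow_le hp.lt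
  obtain ⟨K₂, hK₂⟩ := hdU.exists_lintegral_ballMaximal_rpow_le hr1
  refine ⟨C ^ q * C ^ p' * (K₂ * K₁), fun F hF => ?_⟩
  set g : X → ℝ≥0∞ := fun x => F x / S x with hg
  have hgm : AEMeasurable g μ := hF.div hS
  set G := ∫⁻ x, g x ^ p ∂(μ.withDensity S) with hG
  have hGF : G = ∫⁻ x, F x ^ p * S x ^ (1 - p) ∂μ := by
    rw [hG, lintegral_withDensity_eq_lintegral_mul₀ hS (hgm.pow_const p)]
    refine lintegral_congr_ae ?_
    filter_upwards [h.symm.ae_ne_zero, h.symm.ae_ne_top] with x h0 ht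
    simp only [Pi.mul_apply, hg]
    rw [ENNReal.div_rpow_of_nonneg _ _ hp0.le, div_eq_mul_inv, ← ENNReal.rpow_neg,
      sub_eq_add_neg, ENNReal.rpow_add _ _ h0 ht, ENNReal.rpow_one]
    ring
  set Mg := ballMaximal (μ.withDensity S) 0 g with hMg
  have hMgm : Measurable Mg := measurable_ballSup _
  -- Dividing by `U` turns the `μ`-integral of `Mg ^ (p / r)` over a ball into a `U`-integral, which
  -- `H` controls.
  set φ : X → ℝ≥0∞ := fun x => Mg x ^ (p / r) * (U x)⁻¹ with hφ
  have hφm : AEMeasurable φ μ := (hMgm.pow_const _).aemeasurable.mul hU.inv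
  set H := ballMaximal (μ.withDensity U) 0 φ with hH
  have hUφ : ∀ᵐ x ∂μ, U x * φ x = Mg x ^ (p / r) := by
    filter_upwards [h.ae_ne_zero, h.ae_ne_top] with x h0 ht
    rw [hφ, mul_left_comm, ENNReal.mul_inv_cancel h0 ht, mul_one]
  have hHint : ∫⁻ x, H x ^ r ∂(μ.withDensity U) ≤ K₂ * (K₁ * G) := by
    refine (hK₂ φ (hφm.mono_ac (withDensity_absolutelyContinuous _ _))).trans ?_
    gcongr
    refine le_trans (le_of_eq ?_) (hK₁ g (hgm.mono_ac (withDensity_absolutelyContinuous _ _)))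
    rw [lintegral_withDensity_eq_lintegral_mul₀ hU (hφm.pow_const r),
      lintegral_withDensity_eq_lintegral_mul₀ hS (hMgm.pow_const p).aemeasurable]
    refine lintegral_congr_ae ?_
    filter_upwards [h.ae_ne_zero, h.ae_ne_top, h.ae_eq_rpow] with x h0 ht hx
    simp only [Pi.mul_apply, hφ]
    rw [ENNReal.mul_rpow_of_nonneg _ _ hr0.le, ← ENNReal.rpow_mul, div_mul_cancel₀ _ hr0.ne',
      ENNReal.inv_rpow, ← ENNReal.rpow_neg, mul_left_comm, mul_comm (S x), hx]
    congr 1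
    nth_rewrite 1 [← ENNReal.rpow_one (U x)]
    -- `U^(1-r) = U^(-p'/q) = S`: this identity dictates the choice of `r`.
    rw [← ENNReal.rpow_add _ _ h0 ht, hr]
    congr 1
    field_simp
    ring
  have hpt : ∀ x, ballMaximal μ (1 - (1 / q + 1 / p')) F x ^ q ≤
      C ^ q * C ^ p' * (G ^ (q / p - 1) * H x ^ r) := by
    intro x
    rw [← ENNReal.le_rpow_inv_iff hq0]
    refine ballSup_le fun z ρ hρ hx => ?_
    rw [ENNReal.le_rpow_inv_iff hq0, sub_sub_cancel_left]
    have hIg : ∫⁻ y in ball z ρ, F y ∂μ = ∫⁻ y in ball z ρ, g y ∂(μ.withDensity S) := by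
      rw [setLIntegral_withDensity hS hgm measurableSet_ball]
      refine lintegral_congr_ae (ae_restrict_of_ae ?_)
      filter_upwards [h.symm.ae_ne_zero, h.symm.ae_ne_top] with y h0 ht
      exact (ENNReal.mul_div_cancel h0 ht).symm
    have hs0 := h.symm.measure_ball_ne_zero hμ z hρ
    have hst := h.symm.measure_ball_ne_top hμ z hρ
    have hu0 := h.measure_ball_ne_zero hμ z hρ
    have hut := h.measure_ball_ne_top hμ z hρ
    refine rpow_mul_le_of_average_bounds hp hpq (hμ.measure_ball_ne_zero z hρ)
      (hμ.measure_ball_ne_top z hρ) hu0 hut hs0 hst (hC z ρ hρ) ?_ ?_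
    · rw [hIg]
      have hgm' : AEMeasurable g ((μ.withDensity S).restrict (ball z ρ)) :=
        (hgm.mono_ac (withDensity_absolutelyContinuous _ _)).restrict
      have h1 := ENNReal.lintegral_mul_le_Lp_mul_Lq ((μ.withDensity S).restrict (ball z ρ)) hp
        hgm' (aemeasurable_const (b := (1 : ℝ≥0∞)))
      simp only [Pi.mul_apply, mul_one, ENNReal.one_rpow, setLIntegral_one] at h1
      refine h1.trans ?_
      gcongr
      exact setLIntegral_le_lintegral _ _
    -- The maximal function is uncentred, so the average is below `Mg` on the whole ball and can be
    -- integrated over it.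
    · have hle : ∀ y ∈ ball z ρ,
          (∫⁻ y in ball z ρ, F y ∂μ) / μ.withDensity S (ball z ρ) ≤ Mg y := by
        intro y hy
        rw [hIg]
        exact lintegral_div_measure_le_ballMaximal _ _ hρ hy
      calc ((∫⁻ y in ball z ρ, F y ∂μ) / μ.withDensity S (ball z ρ)) ^ (p / r) * μ (ball z ρ)
          = ∫⁻ _ in ball z ρ,
            ((∫⁻ y in ball z ρ, F y ∂μ) / μ.withDensity S (ball z ρ)) ^ (p / r) ∂μ := by
            rw [setLIntegral_const]
        _ ≤ ∫⁻ y in ball z ρ, Mg y ^ (p / r) ∂μ := by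
            refine setLIntegral_mono' measurableSet_ball fun y hy => ?_
            gcongr
            exact hle y hy
        _ = ∫⁻ y in ball z ρ, φ y ∂(μ.withDensity U) := by
            rw [setLIntegral_withDensity hU hφm measurableSet_ball]
            exact lintegral_congr_ae (ae_restrict_of_ae (hUφ.mono fun y hy => hy.symm))
        _ ≤ H x * μ.withDensity U (ball z ρ) := by
            rw [← ENNReal.div_le_iff hu0 hut]
            exact lintegral_div_measure_le_ballMaximal _ _ hρ hx
  have hqp : 0 ≤ q / p - 1 := by
    rw [sub_nonneg, one_le_div hp0]
    exact hpq.le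
  have hHm : Measurable H := measurable_ballSup _
  rw [← hGF]
  calc ∫⁻ x, ballMaximal μ (1 - (1 / q + 1 / p')) F x ^ q ∂(μ.withDensity U)
      ≤ ∫⁻ x, C ^ q * C ^ p' * (G ^ (q / p - 1) * H x ^ r) ∂(μ.withDensity U) :=
        lintegral_mono hpt
    _ = C ^ q * C ^ p' * (G ^ (q / p - 1) * ∫⁻ x, H x ^ r ∂(μ.withDensity U)) := by
        rw [lintegral_const_mul _ ((hHm.pow_const r).const_mul _),
          lintegral_const_mul _ (hHm.pow_const r)]
    _ ≤ C ^ q * C ^ p' * (G ^ (q / p - 1) * (K₂ * (K₁ * G))) := by gcongr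
    _ = C ^ q * C ^ p' * (K₂ * K₁) * (G ^ (q / p - 1) * G) := by ring
    _ = C ^ q * C ^ p' * (K₂ * K₁) * G ^ (q / p) := by
        congr 1
        nth_rewrite 2 [← ENNReal.rpow_one G]
        rw [← ENNReal.rpow_add_of_nonneg _ _ hqp zero_le_one, sub_add_cancel]
    _ = _ := by
        push_cast [ENNReal.coe_rpow_of_nonneg _ hq0.le, ENNReal.coe_rpow_of_nonneg _ hp'0.le]
        rfl

/-! ### Weak-type estimate -/

/-- The weak-type estimate under an `A_{1,q}` condition. -/
theorem exists_rpow_mul_measure_lt_ballMaximal_le {μ : Measure X} (hμ : IsDoubling μ)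
    {q : ℝ} (hq : 1 ≤ q) {W : X → ℝ≥0∞} (hW : AEMeasurable W μ) (h0 : ∀ᵐ x ∂μ, W x ≠ 0)
    (ht : ∀ᵐ x ∂μ, W x ≠ ∞) {C : ℝ≥0}
    (hA : ∀ (x : X) (r : ℝ), 0 < r → ∀ᵐ z ∂(μ.restrict (ball x r)),
      (μ.withDensity (fun y => W y ^ q) (ball x r)) ^ (1 / q) ≤
        C * W z * μ (ball x r) ^ (1 / q)) :
    ∃ K : ℝ≥0, ∀ F : X → ℝ≥0∞, AEMeasurable F μ → ∀ t : ℝ≥0∞,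
      t ^ q * μ.withDensity (fun y => W y ^ q) {x | t < ballMaximal μ (1 - 1 / q) F x} ≤
        K * (∫⁻ x, F x * W x ∂μ) ^ q := by
  have hq0 : 0 < q := by linarith
  set ν := μ.withDensity (fun y => W y ^ q) with hν
  have hA' : ∀ (x : X) (r : ℝ), 0 < r → ∀ᵐ z ∂(μ.restrict (ball x r)),
      ν (ball x r) ≤ C ^ q * W z ^ q * μ (ball x r) := by
    intro x r hr
    filter_upwards [hA x r hr] with z hz
    have := ENNReal.rpow_le_rpow hz hq0.le
    rwa [ENNReal.mul_rpow_of_nonneg _ _ hq0.le, ENNReal.mul_rpow_of_nonneg _ _ hq0.le,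
      ← ENNReal.rpow_mul, ← ENNReal.rpow_mul, one_div_mul_cancel hq0.ne', ENNReal.rpow_one,
      ENNReal.rpow_one] at this
  obtain ⟨D, hD⟩ := hμ.doubling
  have hνd : IsDoubling ν := by
    refine ⟨fun x r hr => pos_iff_ne_zero.2 ?_, fun x r hr => ?_, C ^ q * D, fun x r hr => ?_⟩
    · refine withDensity_measure_ball_ne_zero hμ (hW.pow_const q) ?_ x hr
      filter_upwards [h0] with y hy
      simp [ENNReal.rpow_eq_zero_iff, hy, hq0.not_gt]
    -- The ball is not null, so some point has finite weight and satisfies the `A_{1,q}` bound.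
    · have : NeZero (μ.restrict (ball x r)) :=
        ⟨by rw [Ne, Measure.restrict_eq_zero]; exact hμ.measure_ball_ne_zero x hr⟩
      obtain ⟨z, hz, hzt⟩ := ((hA' x r hr).and (ae_restrict_of_ae ht)).exists
      refine hz.trans_lt (ENNReal.mul_lt_top (ENNReal.mul_lt_top ?_ ?_)
        (hμ.measure_ball_lt_top x r hr))
      · exact ENNReal.rpow_lt_top_of_nonneg hq0.le ENNReal.coe_ne_top
      · exact ENNReal.rpow_lt_top_of_nonneg hq0.le hzt
    · have hm0 := hμ.measure_ball_ne_zero x hr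
      have hmt := hμ.measure_ball_ne_top x hr
      have hr2 : 0 < 2 * r := by positivity
      have hsub : ball x r ⊆ ball x (2 * r) := ball_subset_ball (by linarith)
      -- Doubling of `ν` comes from integrating over the small ball the pointwise bound valid on the
      -- double ball.
      refine (ENNReal.mul_le_mul_iff_right hm0 hmt).1 ?_
      calc μ (ball x r) * ν (ball x (2 * r)) = ∫⁻ _ in ball x r, ν (ball x (2 * r)) ∂μ := by
            rw [setLIntegral_const, mul_comm]
        _ ≤ ∫⁻ z in ball x r, C ^ q * W z ^ q * (D * μ (ball x r)) ∂μ := by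
            refine lintegral_mono_ae ?_
            filter_upwards [ae_restrict_of_ae_restrict_of_subset hsub (hA' x _ hr2)] with z hz
            refine hz.trans ?_
            gcongr
            exact hD x r hr
        _ = μ (ball x r) * (C ^ q * D * ν (ball x r)) := by
            rw [hν, withDensity_apply _ measurableSet_ball,
              lintegral_mul_const'' _ ((hW.pow_const q).restrict.const_mul _),
              lintegral_const_mul'' _ (hW.pow_const q).restrict]
            ring
        _ = _ := by push_cast [ENNReal.coe_rpow_of_nonneg _ hq0.le]; rfl
  obtain ⟨K, hK⟩ := hνd.exists_rpow_mul_measure_le hq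
  refine ⟨K * C ^ q, fun F hF t => ?_⟩
  refine (hK (μ.withDensity fun x => F x * (C * W x)) t _ fun x hx => ?_).trans (le_of_eq ?_)
  · obtain ⟨z, r, hr, hxz, h⟩ := lt_ballSup_iff.1 hx
    refine ⟨z, r, hr, hxz, ?_⟩
    have hm0 := hμ.measure_ball_ne_zero z hr
    have hmt := hμ.measure_ball_ne_top z hr
    rw [withDensity_apply (fun x => F x * (C * W x)) measurableSet_ball]
    rw [sub_sub_cancel_left] at h
    have hmm : μ (ball z r) ^ (-(1 / q)) * μ (ball z r) ^ (1 / q) = 1 := by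
      rw [← ENNReal.rpow_add _ _ hm0 hmt, neg_add_cancel, ENNReal.rpow_zero]
    calc t * ν (ball z r) ^ (1 / q)
        ≤ μ (ball z r) ^ (-(1 / q)) * (∫⁻ y in ball z r, F y ∂μ) * ν (ball z r) ^ (1 / q) := by
          gcongr
      _ = μ (ball z r) ^ (-(1 / q)) * ∫⁻ y in ball z r, F y * ν (ball z r) ^ (1 / q) ∂μ := by
          rw [lintegral_mul_const'' _ hF.restrict, mul_assoc]
      _ ≤ μ (ball z r) ^ (-(1 / q)) *
          ∫⁻ y in ball z r, F y * (C * W y) * μ (ball z r) ^ (1 / q) ∂μ := by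
          gcongr 1
          refine lintegral_mono_ae ?_
          filter_upwards [hA z r hr] with y hy
          rw [mul_assoc]
          gcongr
      _ = ∫⁻ y in ball z r, F y * (C * W y) ∂μ := by
          rw [lintegral_mul_const' _ _ (ENNReal.rpow_ne_top_of_nonneg (by positivity) hmt),
            mul_left_comm,
            hmm, mul_one]
  · rw [withDensity_apply _ MeasurableSet.univ, setLIntegral_univ]
    have : ∀ x, F x * (C * W x) = C * (F x * W x) := fun x => by ring
    simp_rw [this]
    rw [lintegral_const_mul' _ _ ENNReal.coe_ne_top, ENNReal.mul_rpow_of_nonneg _ _ hq0.le,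
      ENNReal.coe_mul, ENNReal.coe_rpow_of_nonneg _ hq0.le, mul_assoc]

end HomogeneousType

namespace HomogeneousType

variable {X : Type*} [MetricSpace X] [MeasurableSpace X]

/-! ### Reduction to measure normalization, and degenerate weights -/

lemma fracMaximal_eq_ballSup (μ : Measure X) (α : ℝ) (f : X → ℂ) :
    fracMaximal μ α f =
      ballSup fun z r => ENNReal.ofReal (r ^ α) * ⨍⁻ y in ball z r, ‖f y‖ₑ ∂μ := rfl

lemma exists_fracMaximal_le_ballMaximal {μ : Measure X} (hμ : IsDoubling μ) {n α : ℝ}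
    (hn : HasLowerGrowth μ n) (hn0 : 0 < n) (hα : 0 < α) :
    ∃ A : ℝ≥0, ∀ (f : X → ℂ) (x : X),
      fracMaximal μ α f x ≤ ballMaximal μ (α / n) (fun y => A * ‖f y‖ₑ) x := by
  obtain ⟨c, hc, h⟩ := hn
  have hγ : 0 < α / n := by positivity
  refine ⟨(c⁻¹) ^ (α / n), fun f x => ?_⟩
  rw [fracMaximal_eq_ballSup]
  refine ballSup_le fun z r hr hx => ?_
  refine le_trans ?_ (le_ballSup _ hr hx)
  have hm0 := hμ.measure_ball_ne_zero z hr
  have hmt := hμ.measure_ball_ne_top z hr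
  have hrα : ENNReal.ofReal (r ^ α) ≤ ((c⁻¹) ^ (α / n) : ℝ≥0) * μ (ball z r) ^ (α / n) := by
    rw [ENNReal.coe_rpow_of_nonneg _ hγ.le, ← ENNReal.mul_rpow_of_nonneg _ _ hγ.le]
    have e : ENNReal.ofReal (r ^ α) = ENNReal.ofReal (r ^ n) ^ (α / n) := by
      rw [ENNReal.ofReal_rpow_of_nonneg (by positivity) hγ.le, ← Real.rpow_mul hr.le,
        mul_div_cancel₀ _ hn0.ne']
    rw [e]
    gcongr
    calc ENNReal.ofReal (r ^ n) = (c⁻¹ : ℝ≥0) * (c * ENNReal.ofReal (r ^ n)) := by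
          rw [← mul_assoc, ← ENNReal.coe_mul, inv_mul_cancel₀ hc.ne', ENNReal.coe_one, one_mul]
      _ ≤ _ := by gcongr; exact h z r hr
  rw [setLAverage_eq, lintegral_const_mul' _ _ ENNReal.coe_ne_top, ENNReal.rpow_sub _ _ hm0 hmt,
    ENNReal.rpow_one, div_eq_mul_inv, div_eq_mul_inv]
  calc _ ≤ ((c⁻¹) ^ (α / n) : ℝ≥0) * μ (ball z r) ^ (α / n) *
        ((∫⁻ y in ball z r, ‖f y‖ₑ ∂μ) * (μ (ball z r))⁻¹) := by gcongr
    _ = _ := by ring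

lemma weightedMeasure_rpow {Y : Type*} [MeasurableSpace Y] {μ : Measure Y} {w : Y → ℝ}
    (hw : ∀ x, 0 ≤ w x) {s : ℝ}
    (hs : 0 ≤ s) :
    weightedMeasure μ (fun x => w x ^ s) = μ.withDensity fun x => ENNReal.ofReal (w x) ^ s := by
  unfold weightedMeasure
  congr with x
  exact (ENNReal.ofReal_rpow_of_nonneg (hw x) hs).symm

/-- If the first alternative fails on one ball, it fails on every larger concentric ball; these
exhaust the space, so the second alternative holds throughout. -/
lemma ae_ne_zero_or_ae_eq_zero {μ : Measure X} {W : X → ℝ≥0∞}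
    (h : ∀ (x : X) (r : ℝ), 0 < r → (∀ᵐ y ∂(μ.restrict (ball x r)), W y ≠ 0) ∨
      ∀ᵐ y ∂(μ.restrict (ball x r)), W y = 0) :
    (∀ᵐ y ∂μ, W y ≠ 0) ∨ ∀ᵐ y ∂μ, W y = 0 := by
  rcases isEmpty_or_nonempty X with hX | ⟨⟨x₀⟩⟩
  · exact .inl (by simp [Measure.eq_zero_of_isEmpty μ])
  have hglue : ∀ P : X → Prop, (∀ k : ℕ, ∀ᵐ y ∂(μ.restrict (ball x₀ k)), P y) →
      ∀ᵐ y ∂μ, P y := fun P hP => by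
    rwa [← ae_restrict_iUnion_iff, iUnion_ball_nat, Measure.restrict_univ] at hP
  by_cases hall : ∀ k : ℕ, ∀ᵐ y ∂(μ.restrict (ball x₀ k)), W y ≠ 0
  · exact .inl (hglue _ hall)
  · push Not at hall
    obtain ⟨k, hk⟩ := hall
    refine .inr (hglue _ fun j => ?_)
    have hj : (j : ℝ) ≤ j + k + 1 := by linarith [k.cast_nonneg (α := ℝ)]
    have hk' : (k : ℝ) ≤ j + k + 1 := by linarith [j.cast_nonneg (α := ℝ)]
    rcases h x₀ (j + k + 1) (by positivity) with h1 | h1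
    · exact absurd (ae_restrict_of_ae_restrict_of_subset (ball_subset_ball hk') h1) hk
    · exact ae_restrict_of_ae_restrict_of_subset (ball_subset_ball hj) h1

lemma ae_eq_zero_of_setLAverage_rpow_eq_zero {μ : Measure X} (hμ : IsDoubling μ) {W : X → ℝ≥0∞}
    (hW : AEMeasurable W μ) {q : ℝ} (hq : 0 < q) {x : X} {r : ℝ} (hr : 0 < r)
    (h : (⨍⁻ y in ball x r, W y ^ q ∂μ) ^ (1 / q) = 0) :
    ∀ᵐ y ∂(μ.restrict (ball x r)), W y = 0 := by
  rw [ENNReal.rpow_eq_zero_iff_of_pos (by positivity), setLAverage_eq, ENNReal.div_eq_zero_iff,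
    or_iff_left (hμ.measure_ball_ne_top x hr),
    lintegral_eq_zero_iff' (hW.pow_const q).restrict] at h
  filter_upwards [h] with y hy
  exact (ENNReal.rpow_eq_zero_iff_of_pos hq).1 hy

/-- An infinite integral of `W ^ (-p')` forces the other factor to be 0; a finite one forces `W ≠ 0`
a.e. -/
lemma ae_ne_zero_or_ae_eq_zero_of_apq {μ : Measure X} (hμ : IsDoubling μ) {W : X → ℝ≥0∞}
    (hW : AEMeasurable W μ) {p' q : ℝ} (hp' : 0 < p') (hq : 0 < q) {C : ℝ≥0}
    (hA : ∀ (x : X) (r : ℝ), 0 < r → (⨍⁻ y in ball x r, W y ^ q ∂μ) ^ (1 / q) *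
      (⨍⁻ y in ball x r, W y ^ (-p') ∂μ) ^ (1 / p') ≤ C) :
    (∀ᵐ y ∂μ, W y ≠ 0) ∨ ∀ᵐ y ∂μ, W y = 0 := by
  refine ae_ne_zero_or_ae_eq_zero fun x r hr => ?_
  by_cases hfin : ∫⁻ y in ball x r, W y ^ (-p') ∂μ = ∞
  · right
    refine ae_eq_zero_of_setLAverage_rpow_eq_zero hμ hW hq hr ?_
    by_contra h0
    have h1 := hA x r hr
    rw [setLAverage_eq μ (fun y => W y ^ (-p')), hfin,
      ENNReal.top_div_of_ne_top (hμ.measure_ball_ne_top x hr),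
      ENNReal.top_rpow_of_pos (by positivity), ENNReal.mul_top h0, top_le_iff] at h1
    exact ENNReal.coe_ne_top h1
  · left
    filter_upwards [ae_lt_top' (hW.pow_const (-p')).restrict hfin] with y hy h0
    simp [h0, ENNReal.zero_rpow_of_neg (neg_lt_zero.2 hp')] at hy

/-- If `W` vanishes on a non-null part of a ball, the condition at such a point makes the average of
`W ^ q` zero. -/
lemma ae_ne_zero_or_ae_eq_zero_of_a1q {μ : Measure X} (hμ : IsDoubling μ) {W : X → ℝ≥0∞}
    (hW : AEMeasurable W μ) {q : ℝ} (hq : 0 < q) {C : ℝ≥0}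
    (hA : ∀ (x : X) (r : ℝ), 0 < r → ∀ᵐ z ∂(μ.restrict (ball x r)),
      (⨍⁻ y in ball x r, W y ^ q ∂μ) ^ (1 / q) ≤ C * W z) :
    (∀ᵐ y ∂μ, W y ≠ 0) ∨ ∀ᵐ y ∂μ, W y = 0 := by
  refine ae_ne_zero_or_ae_eq_zero fun x r hr => or_iff_not_imp_left.2 fun h => ?_
  refine ae_eq_zero_of_setLAverage_rpow_eq_zero hμ hW hq hr ?_
  rw [← Filter.Frequently] at h
  obtain ⟨z, hz, hzA⟩ := (h.and_eventually (hA x r hr)).exists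
  simpa [hz] using hzA

variable [BorelSpace X]

lemma measurable_fracMaximal (μ : Measure X) (α : ℝ) (f : X → ℂ) :
    Measurable (fracMaximal μ α f) :=
  measurable_ballSup _

lemma isMuckenhouptPair_of_apq {μ : Measure X} (hμ : IsDoubling μ) {W : X → ℝ≥0∞}
    (hW : AEMeasurable W μ) (h0 : ∀ᵐ x ∂μ, W x ≠ 0) (ht : ∀ᵐ x ∂μ, W x ≠ ∞)
    {p' q : ℝ} (hp' : 0 < p') (hq : 0 < q) {C : ℝ≥0}
    (hA : ∀ (x : X) (r : ℝ), 0 < r → (⨍⁻ y in ball x r, W y ^ q ∂μ) ^ (1 / q) *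
      (⨍⁻ y in ball x r, W y ^ (-p') ∂μ) ^ (1 / p') ≤ C) :
    IsMuckenhouptPair μ (1 / q) (1 / p') (fun x => W x ^ q) (fun x => W x ^ (-p')) where
  left_pos := by positivity
  right_pos := by positivity
  aemeasurable_left := hW.pow_const q
  aemeasurable_right := hW.pow_const (-p')
  mul_eq_one := by
    filter_upwards [h0, ht] with x hx hxt
    rw [← ENNReal.rpow_mul, ← ENNReal.rpow_mul, neg_mul, mul_one_div_cancel hq.ne',
      mul_one_div_cancel hp'.ne', ← ENNReal.rpow_add _ _ hx hxt, add_neg_cancel, ENNReal.rpow_zero]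
  bound := by
    refine ⟨C, fun x r hr => ?_⟩
    have hm0 := hμ.measure_ball_ne_zero x hr
    have hmt := hμ.measure_ball_ne_top x hr
    have e : ∀ {s : ℝ} (_ : 0 < s) (F : X → ℝ≥0∞), (μ.withDensity F (ball x r)) ^ (1 / s) =
        (⨍⁻ y in ball x r, F y ∂μ) ^ (1 / s) * μ (ball x r) ^ (1 / s) := fun hs F => by
      rw [← ENNReal.mul_rpow_of_nonneg _ _ (by positivity), setLAverage_eq,
        ENNReal.div_mul_cancel hm0 hmt, withDensity_apply _ measurableSet_ball]
    rw [e hq, e hp', mul_mul_mul_comm, ← ENNReal.rpow_add _ _ hm0 hmt]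
    gcongr
    exact hA x r hr

end HomogeneousType

/-! ### The theorem -/

open HomogeneousType in
theorem mainTheorem5 {X : Type*} [MetricSpace X] [MeasurableSpace X] [BorelSpace X]
    (μ : Measure X) (n α p q : ℝ)
    (hμ : HomogeneousType.IsDoubling μ) (hn : HomogeneousType.HasLowerGrowth μ n)
    (hα : 0 < α) (hαn : α < n) (hp : 1 ≤ p) (hpn : p < n / α)
    (hq : 1 / q = 1 / p - α / n)
    (w : X → ℝ) (hw : HomogeneousType.IsApq μ p q w) :
    (1 < p → ∃ C : ℝ≥0, ∀ f : X → ℂ,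
      MemLp f (ENNReal.ofReal p) (HomogeneousType.weightedMeasure μ (fun x => w x ^ p)) →
        MemLp (HomogeneousType.fracMaximal μ α f) (ENNReal.ofReal q)
          (HomogeneousType.weightedMeasure μ (fun x => w x ^ q)) ∧
        eLpNorm (HomogeneousType.fracMaximal μ α f) (ENNReal.ofReal q)
            (HomogeneousType.weightedMeasure μ (fun x => w x ^ q)) ≤
          C * eLpNorm f (ENNReal.ofReal p)
            (HomogeneousType.weightedMeasure μ (fun x => w x ^ p))) ∧
    (p = 1 → ∃ C : ℝ≥0, ∀ f : X → ℂ,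
      MemLp f 1 (HomogeneousType.weightedMeasure μ w) →
        HomogeneousType.MemWeakLp (HomogeneousType.fracMaximal μ α f) q
          (HomogeneousType.weightedMeasure μ (fun x => w x ^ q)) ∧
        HomogeneousType.weakLpNorm (HomogeneousType.fracMaximal μ α f) q
            (HomogeneousType.weightedMeasure μ (fun x => w x ^ q)) ≤
          C * eLpNorm f 1 (HomogeneousType.weightedMeasure μ w)) := by
  have hn0 : 0 < n := hα.trans hαn
  have hp0 : 0 < p := by linarith
  have hγ : 0 < α / n := by positivity
  have hq0 : 0 < q := by
    rw [← one_div_pos, hq, sub_pos, div_lt_div_iff₀ hn0 hp0]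
    rw [lt_div_iff₀ hα] at hpn
    linarith
  have hpq : p < q := by
    rw [← one_div_lt_one_div hq0 hp0]
    linarith
  obtain ⟨⟨hw0, hwm, -⟩, C, hC⟩ := hw
  obtain ⟨A, hA⟩ := exists_fracMaximal_le_ballMaximal hμ hn hn0 hα
  set W : X → ℝ≥0∞ := fun x => ENNReal.ofReal (w x) with hWdef
  have hW : AEMeasurable W μ := hwm.ennreal_ofReal
  have hWt : ∀ᵐ x ∂μ, W x ≠ ∞ := .of_forall fun x => ENNReal.ofReal_ne_top
  have hmq : weightedMeasure μ (fun x => w x ^ q) = μ.withDensity fun x => W x ^ q :=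
    weightedMeasure_rpow hw0 hq0.le
  have hmp : weightedMeasure μ (fun x => w x ^ p) = μ.withDensity fun x => W x ^ p :=
    weightedMeasure_rpow hw0 hp0.le
  have hdeg : (∀ᵐ y ∂μ, W y = 0) → weightedMeasure μ (fun x => w x ^ q) = 0 := fun h => by
    rw [hmq, withDensity_congr_ae (g := 0), withDensity_zero]
    filter_upwards [h] with y hy
    simp [hy, ENNReal.zero_rpow_of_pos hq0]
  constructor
  · intro hp1
    obtain ⟨-, hC⟩ | ⟨hp1', -⟩ := hC
    swap
    · exact absurd hp1' hp1.ne'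
    have hpp := Real.HolderConjugate.conjExponent hp1
    set p' := p.conjExponent
    have hp'0 : 0 < p' := hpp.symm.pos
    obtain h0 | h0 := ae_ne_zero_or_ae_eq_zero_of_apq hμ hW hp'0 hq0 hC
    swap
    · refine ⟨0, fun f _ => ⟨⟨(measurable_fracMaximal μ α f).aestronglyMeasurable, ?_⟩, ?_⟩⟩ <;>
        simp [hdeg h0]
    have hpair := isMuckenhouptPair_of_apq hμ hW h0 hWt hp'0 hq0 hC
    obtain ⟨K, hK⟩ := hpair.exists_lintegral_ballMaximal_le hμ hpp hpq
    have hexp : 1 - (1 / q + 1 / p') = α / n := by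
      have := hpp.inv_add_inv_eq_one
      rw [← one_div, ← one_div] at this
      linarith
    rw [hexp] at hK
    have hqt : (ENNReal.ofReal q).toReal = q := ENNReal.toReal_ofReal hq0.le
    have hpt : (ENNReal.ofReal p).toReal = p := ENNReal.toReal_ofReal hp0.le
    have main : ∀ f : X → ℂ,
        MemLp f (ENNReal.ofReal p) (weightedMeasure μ (fun x => w x ^ p)) →
        eLpNorm (fracMaximal μ α f) (ENNReal.ofReal q) (weightedMeasure μ (fun x => w x ^ q)) ≤
          (K ^ (1 / q) * A : ℝ≥0) *
            eLpNorm f (ENNReal.ofReal p) (weightedMeasure μ (fun x => w x ^ p)) := by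
      intro f hf
      rw [hmp] at hf ⊢
      -- Measurability of `f` is given only for the weighted measure; a.e. positivity of the weight
      -- transfers it to `μ`.
      have hac : μ ≪ μ.withDensity fun x => W x ^ p :=
        withDensity_absolutelyContinuous' (hW.pow_const p) <| by
          filter_upwards [h0] with x hx
          simp [ENNReal.rpow_eq_zero_iff, hx, hp0.not_gt]
      have hfm : AEMeasurable (fun x => ‖f x‖ₑ) μ := (hf.1.mono_ac hac).enorm
      -- `S^(1-p) = w^p`, since `p'(p-1) = p`.
      have hS : ∀ᵐ x ∂μ, (A * ‖f x‖ₑ) ^ p * (W x ^ (-p')) ^ (1 - p) =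
          A ^ p * (W x ^ p * ‖f x‖ₑ ^ p) := by
        refine .of_forall fun x => ?_
        rw [ENNReal.mul_rpow_of_nonneg _ _ hp0.le, ← ENNReal.rpow_mul,
          show -p' * (1 - p) = p by linarith [hpp.mul_eq_add]]
        ring
      rw [hmq, eLpNorm_eq_lintegral_rpow_enorm_toReal (by simpa using hq0) (by simp),
        eLpNorm_eq_lintegral_rpow_enorm_toReal (by simpa using hp0) (by simp), hqt, hpt,
        lintegral_withDensity_eq_lintegral_mul₀ (hW.pow_const p) (hfm.pow_const p)]
      calc (∫⁻ x, ‖fracMaximal μ α f x‖ₑ ^ q ∂(μ.withDensity fun x => W x ^ q)) ^ (1 / q)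
          ≤ (∫⁻ x, ballMaximal μ (α / n) (fun y => A * ‖f y‖ₑ) x ^ q
              ∂(μ.withDensity fun x => W x ^ q)) ^ (1 / q) := by
            gcongr with x
            exact hA f x
        _ ≤ (K * (∫⁻ x, (A * ‖f x‖ₑ) ^ p * (W x ^ (-p')) ^ (1 - p) ∂μ) ^ (q / p)) ^ (1 / q) := by
            gcongr
            exact hK _ (hfm.const_mul _)
        _ = _ := by
            rw [lintegral_congr_ae hS, lintegral_const_mul' _ _
              (ENNReal.rpow_ne_top_of_nonneg hp0.le ENNReal.coe_ne_top),
              ENNReal.mul_rpow_of_nonneg _ _ (by positivity), ← ENNReal.rpow_mul,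
              show q / p * (1 / q) = 1 / p by field_simp,
              ENNReal.mul_rpow_of_nonneg _ _ (by positivity), ← ENNReal.rpow_mul,
              mul_one_div_cancel hp0.ne', ENNReal.rpow_one, ENNReal.coe_mul,
              ENNReal.coe_rpow_of_nonneg _ (by positivity), mul_assoc]
            rfl
    exact ⟨K ^ (1 / q) * A, fun f hf =>
      ⟨⟨(measurable_fracMaximal μ α f).aestronglyMeasurable,
        (main f hf).trans_lt (ENNReal.mul_lt_top ENNReal.coe_lt_top hf.2)⟩, main f hf⟩⟩
  · rintro rfl
    obtain ⟨hp1, -⟩ | ⟨-, hC⟩ := hC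
    · exact absurd hp1 (lt_irrefl _)
    obtain h0 | h0 := ae_ne_zero_or_ae_eq_zero_of_a1q hμ hW hq0 hC
    swap
    · have hz : ∀ f : X → ℂ, weakLpNorm (fracMaximal μ α f) q
          (weightedMeasure μ (fun x => w x ^ q)) = 0 := fun f => by
        simp [weakLpNorm, hdeg h0, hq0]
      exact ⟨0, fun f _ => ⟨⟨(measurable_fracMaximal μ α f).aestronglyMeasurable, by simp [hz]⟩,
        by simp [hz]⟩⟩
    obtain ⟨K, hK⟩ := exists_rpow_mul_measure_lt_ballMaximal_le hμ hpq.le hW h0 hWt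
      (C := C) fun x r hr => by
        have hm0 := hμ.measure_ball_ne_zero x hr
        have hmt := hμ.measure_ball_ne_top x hr
        filter_upwards [hC x r hr] with z hz
        rw [withDensity_apply _ measurableSet_ball, ← ENNReal.div_mul_cancel hm0 hmt
          (b := ∫⁻ y in ball x r, W y ^ q ∂μ), ENNReal.mul_rpow_of_nonneg _ _ (by positivity),
          ← setLAverage_eq]
        gcongr
    have hexp : 1 - 1 / q = α / n := by rw [hq]; ring
    rw [hexp] at hK
    have main : ∀ f : X → ℂ, MemLp f 1 (weightedMeasure μ w) →
        weakLpNorm (fracMaximal μ α f) q (weightedMeasure μ (fun x => w x ^ q)) ≤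
          (K ^ (1 / q) * A : ℝ≥0) * eLpNorm f 1 (weightedMeasure μ w) := by
      intro f hf
      change MemLp f 1 (μ.withDensity W) at hf
      change _ ≤ _ * eLpNorm f 1 (μ.withDensity W)
      have hac : μ ≪ μ.withDensity W := withDensity_absolutelyContinuous' hW h0
      have hfm : AEMeasurable (fun x => ‖f x‖ₑ) μ := (hf.1.mono_ac hac).enorm
      rw [hmq, eLpNorm_one_eq_lintegral_enorm, lintegral_withDensity_eq_lintegral_mul₀ hW hfm]
      refine iSup_le fun t => ?_
      have h1 : (t : ℝ≥0∞) ^ q * μ.withDensity (fun x => W x ^ q) {x | t < fracMaximal μ α f x} ≤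
          K * (A * ∫⁻ x, W x * ‖f x‖ₑ ∂μ) ^ q := by
        refine le_trans ?_ ((hK _ (hfm.const_mul A) t).trans (le_of_eq ?_))
        · gcongr with x
          exact hA f x
        · rw [← lintegral_const_mul' _ _ ENNReal.coe_ne_top]
          congr! 4 with x
          ring
      have h2 := ENNReal.rpow_le_rpow h1 (one_div_nonneg.2 hq0.le)
      rw [ENNReal.mul_rpow_of_nonneg _ _ (by positivity),
        ENNReal.mul_rpow_of_nonneg _ _ (by positivity), ← ENNReal.rpow_mul, ← ENNReal.rpow_mul,
        mul_one_div_cancel hq0.ne', ENNReal.rpow_one, ENNReal.rpow_one, ← mul_assoc] at h2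
      rw [ENNReal.coe_mul, ENNReal.coe_rpow_of_nonneg _ (by positivity)]
      exact h2
    exact ⟨K ^ (1 / q) * A, fun f hf =>
      ⟨⟨(measurable_fracMaximal μ α f).aestronglyMeasurable,
        (main f hf).trans_lt (ENNReal.mul_lt_top ENNReal.coe_lt_top hf.2)⟩, main f hf⟩⟩
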